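/- Let $N\ge 0$ be an integer and let $(X_t)_{t\ge 0}$ be a continuous-time birth-and-death chain on $\{0,\dots,N\}$ started at $0$, that is, a right-continuous Markov chain with $X_0=0$ and transition semigroup $e^{tQ}$, where the generator $Q$ (nonnegative off-diagonal entries, rows summing to $0$) satisfies $Q(x,y)=0$ whenever $|x-y|>1$. Suppose that $Q$ is irreducible and symmetric in the sense that $Q(N-x,N-y)=Q(x,y)$ for all $x,y\in\{0,\dots,N\}$. Let $\pi$ be its stationary distribution ($\pi Q=0$), let $\pi_t$ be the distribution of $X_t$, and let $x^*=\left[\frac{N+1}{2}\right]$ be the integer part of $\frac{N+1}{2}$. Then $x^*$ is a halting state for total variation, that is, for all $t\ge 0$, $$\pi_t(x^*)\le \pi(x^*),$$ and $\{x^*\}$ is a halting set: for all $t\ge 0$, $$\|\pi_t-\pi\|_{TV}=\frac12\sum_{x=0}^{N}|\pi_t(x)-\pi(x)|\le \mathbb P(T_{x^*}>t),$$ where $T_{x^*}=\inf\{t\ge 0: X_t=x^*\}$ is the hitting time of $x^*$ (with $\inf\emptyset=+\infty$). -/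

import Mathlib

open MeasureTheory
open scoped NNReal Matrix

namespace HaltingState

/-- `Q` is the generator of a continuous-time Markov chain on the finite set `S`: the
off-diagonal entries (jump rates) are nonnegative and every row sums to zero. -/
structure IsGenerator {S : Type*} [Fintype S] (Q : Matrix S S ℝ) : Prop where
  nonneg : ∀ x y, x ≠ y → 0 ≤ Q x y
  row_sum : ∀ x, ∑ y, Q x y = 0

/-- Irreducibility: any state can be reached from any other through jumps of positive rate. -/
def IsIrreducible {S : Type*} (Q : Matrix S S ℝ) : Prop :=
  ∀ x y, Relation.ReflTransGen (fun a b => a ≠ b ∧ 0 < Q a b) x y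

/-- On `{0, …, N}`, the only possible jumps are from `x` to `x + 1` or `x - 1`. -/
def IsBirthDeath {N : ℕ} (Q : Matrix (Fin (N + 1)) (Fin (N + 1)) ℝ) : Prop :=
  ∀ x y : Fin (N + 1), (x : ℕ) + 1 < y ∨ (y : ℕ) + 1 < x → Q x y = 0

/-- Symmetry under the reflection `x ↦ N - x` of `{0, …, N}` (`Fin.rev x` is `N - x`). -/
def IsSymmetric {N : ℕ} (Q : Matrix (Fin (N + 1)) (Fin (N + 1)) ℝ) : Prop :=
  ∀ x y, Q x.rev y.rev = Q x y

/-- `p` is a probability distribution on the finite set `S`. -/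
structure IsDistribution {S : Type*} [Fintype S] (p : S → ℝ) : Prop where
  nonneg : ∀ x, 0 ≤ p x
  sum_eq_one : ∑ x, p x = 1

/-- `p` is a stationary distribution of the chain with generator `Q`: `p Q = 0`. -/
structure IsStationary {S : Type*} [Fintype S] (Q : Matrix S S ℝ) (p : S → ℝ) : Prop
    extends IsDistribution p where
  vecMul_eq_zero : p ᵥ* Q = 0

/-- `X = (X_t)_{t ≥ 0}` is, under `P`, a continuous-time Markov chain on the finite set `S` with
initial distribution `p₀` and generator `Q`: almost every path is right-continuous (for the
discrete topology of `S`) and, for all times `0 = t₀ ≤ t₁ ≤ … ≤ tₙ` and all states `x₀, …, xₙ`,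
`P(X_{t₀} = x₀, …, X_{tₙ} = xₙ) = p₀(x₀) ∏_{i < n} e^{(t_{i+1} - t_i) Q}(x_i, x_{i+1})`. -/
structure IsMarkovChain {S Ω : Type*} [Fintype S] [DecidableEq S] [MeasurableSpace Ω]
    (Q : Matrix S S ℝ) (p₀ : S → ℝ) (P : Measure Ω) (X : ℝ≥0 → Ω → S) : Prop where
  measurableSet_eq : ∀ t x, MeasurableSet {ω | X t ω = x}
  right_continuous : ∀ᵐ ω ∂P, ∀ t : ℝ≥0, ∃ ε > 0, ∀ s, t ≤ s → s < t + ε → X s ω = X t ω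
  finite_dim : ∀ (n : ℕ) (t : Fin (n + 1) → ℝ≥0), Monotone t → t 0 = 0 →
    ∀ x : Fin (n + 1) → S,
      P.real {ω | ∀ i, X (t i) ω = x i} =
        p₀ (x 0) * ∏ i : Fin n,
          NormedSpace.exp (((t i.succ : ℝ) - (t i.castSucc : ℝ)) • Q) (x i.castSucc) (x i.succ)

/-- The distribution of `X_t`, as a function on the state space: `x ↦ P(X_t = x)`. -/
noncomputable def law {S Ω : Type*} [MeasurableSpace Ω] (P : Measure Ω) (X : ℝ≥0 → Ω → S)
    (t : ℝ≥0) : S → ℝ :=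
  fun x => P.real {ω | X t ω = x}

/-- Total variation distance between two distributions on a finite set. -/
noncomputable def tvDist {S : Type*} [Fintype S] (p q : S → ℝ) : ℝ :=
  (1 / 2) * ∑ x, |p x - q x|

/-- `A` is a halting set for total variation: `‖π_t - π‖_TV ≤ P(T_A > t)` for all `t ≥ 0`, where
`π_t` is the distribution of `X_t` and `T_A` (possibly infinite) the hitting time of `A`. -/
def IsHaltingSet {S Ω : Type*} [Fintype S] [MeasurableSpace Ω] (P : Measure Ω)
    (X : ℝ≥0 → Ω → S) (π : S → ℝ) (A : Set S) : Prop :=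
  ∀ t : ℝ≥0, tvDist (law P X t) π ≤ P.real {ω | (t : WithTop ℝ≥0) < hittingAfter X A 0 ω}

/-- `x` is a halting state for total variation: `π_t(x) ≤ π(x)` for all `t ≥ 0`, and `{x}` is a
halting set. (The first property is known to imply the second; both are asked for.) -/
def IsHaltingState {S Ω : Type*} [Fintype S] [MeasurableSpace Ω] (P : Measure Ω)
    (X : ℝ≥0 → Ω → S) (π : S → ℝ) (x : S) : Prop :=
  (∀ t : ℝ≥0, law P X t x ≤ π x) ∧ IsHaltingSet P X π {x}

end HaltingState

namespace HaltingState

/-! Write `P_t = e^{tQ}`, `a` for the middle state and `a' = N - a` (so `a' = a` when `N` is even).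
The semigroup preserves the cone of symmetric functions that increase towards the middle. Hence `P_t
(1_a + 1_a')` is smallest at `0`, where it is at most its `π`-mean, which is `π(a) + π(a')` by
stationarity. The semigroup also preserves the antisymmetric functions that are nonnegative on the
left half; applied to `1_a' - 1_a`, this gives `P_t(0, a) ≤ P_t(0, a')`. Since `π(a) = π(a')`,
adding the two bounds yields `P_t(0, a) ≤ π(a)`; this is `exp_zero_half_le`.

The halting property then holds for any finite chain and any state `a` that never exceeds its
equilibrium mass. Along a time grid, the excess `π_t - π` is propagated by a nonnegative kernel and
is nonpositive at `a`, so by induction it is dominated by the law of the chain killed at `a`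
(`IsMarkovChain.law_sub_le_avoidLaw`). Summing positive parts bounds total variation by the
probability of avoiding `a` on the grid; dyadic refinement and right-continuity turn this into the
hitting time. -/

theorem IsGenerator.mulVec_apply {S : Type*} [Fintype S] {Q : Matrix S S ℝ} (hQ : IsGenerator Q)
    (f : S → ℝ) (x : S) (a : ℝ) :
    (Q *ᵥ f) x = ∑ y, Q x y * (f y - a) := by
  simp only [Matrix.mulVec, dotProduct, mul_sub, Finset.sum_sub_distrib, ← Finset.sum_mul,
    hQ.row_sum, zero_mul, sub_zero]

/-! ### Matrix exponentials and invariant cones -/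

section Semigroup

variable {S : Type*} [Fintype S] [DecidableEq S]

open scoped Matrix.Norms.Operator in
theorem hasSum_exp_mulVec (A : Matrix S S ℝ) (f : S → ℝ) :
    HasSum (fun n : ℕ => ((n.factorial : ℝ)⁻¹ • A ^ n) *ᵥ f) (NormedSpace.exp A *ᵥ f) := by
  have h : HasSum (fun n : ℕ => ((n.factorial : ℝ)⁻¹ • A ^ n)) (NormedSpace.exp A) :=
    NormedSpace.exp_series_hasSum_exp' (𝕂 := ℝ) A
  exact h.map (⟨⟨(· *ᵥ f), Matrix.zero_mulVec f⟩, fun A B => Matrix.add_mulVec A B f⟩ :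
    Matrix S S ℝ →+ (S → ℝ)) (continuous_id.matrix_mulVec continuous_const)

open scoped Matrix.Norms.Operator in
theorem hasSum_vecMul_exp (A : Matrix S S ℝ) (f : S → ℝ) :
    HasSum (fun n : ℕ => f ᵥ* ((n.factorial : ℝ)⁻¹ • A ^ n)) (f ᵥ* NormedSpace.exp A) := by
  have h : HasSum (fun n : ℕ => ((n.factorial : ℝ)⁻¹ • A ^ n)) (NormedSpace.exp A) :=
    NormedSpace.exp_series_hasSum_exp' (𝕂 := ℝ) A
  exact h.map (⟨⟨(f ᵥ* ·), Matrix.vecMul_zero f⟩, fun A B => Matrix.vecMul_add A B f⟩ :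
    Matrix S S ℝ →+ (S → ℝ)) (continuous_const.matrix_vecMul continuous_id)

theorem vecMul_exp_of_vecMul_eq_zero {A : Matrix S S ℝ} {p : S → ℝ} (h : p ᵥ* A = 0) :
    p ᵥ* NormedSpace.exp A = p := by
  have h1 : HasSum (fun n : ℕ => p ᵥ* ((n.factorial : ℝ)⁻¹ • A ^ n)) p := by
    convert hasSum_single (f := fun n : ℕ => p ᵥ* ((n.factorial : ℝ)⁻¹ • A ^ n)) 0 ?_ using 1
    · simp
    · intro n hn
      obtain ⟨k, rfl⟩ := Nat.exists_eq_succ_of_ne_zero hn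
      simp [pow_succ', Matrix.vecMul_smul, ← Matrix.vecMul_vecMul, h]
  exact (hasSum_vecMul_exp A p).unique h1

theorem exp_smul_one (c : ℝ) :
    NormedSpace.exp (c • (1 : Matrix S S ℝ)) = Real.exp c • (1 : Matrix S S ℝ) := by
  rw [Matrix.smul_one_eq_diagonal, Matrix.exp_diagonal, Matrix.smul_one_eq_diagonal]
  congr 1
  ext i
  rw [Pi.coe_exp, Real.exp_eq_exp_ℝ]

theorem exp_add_smul (Q : Matrix S S ℝ) (s t : ℝ) :
    NormedSpace.exp ((s + t) • Q) = NormedSpace.exp (s • Q) * NormedSpace.exp (t • Q) := by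
  rw [add_smul]
  exact Matrix.exp_add_of_commute _ _ (((Commute.refl Q).smul_left s).smul_right t)

theorem exp_mulVec_mem_of_mapsTo {C : PointedCone ℝ (S → ℝ)} (hC : IsClosed (C : Set (S → ℝ)))
    {A : Matrix S S ℝ} (hA : ∀ f ∈ C, A *ᵥ f ∈ C) {f : S → ℝ} (hf : f ∈ C) :
    NormedSpace.exp A *ᵥ f ∈ C := by
  have hpow : ∀ n : ℕ, (A ^ n) *ᵥ f ∈ C := by
    intro n
    induction n with
    | zero => simpa using hf
    | succ n ih => rw [pow_succ', ← Matrix.mulVec_mulVec]; exact hA _ ih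
  refine hC.mem_of_tendsto (hasSum_exp_mulVec A f) (Filter.Eventually.of_forall fun s => ?_)
  refine C.sum_mem fun n _ => ?_
  rw [Matrix.smul_mulVec]
  exact C.smul_mem (inv_nonneg.2 (Nat.cast_nonneg _)) (hpow n)

/-- A closed convex cone that is preserved by `Q + c` is preserved by the semigroup of `Q`. -/
theorem exp_mulVec_mem {C : PointedCone ℝ (S → ℝ)} (hC : IsClosed (C : Set (S → ℝ)))
    {Q : Matrix S S ℝ} (c : ℝ) (hQ : ∀ f ∈ C, Q *ᵥ f + c • f ∈ C) {t : ℝ} (ht : 0 ≤ t)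
    {f : S → ℝ} (hf : f ∈ C) : NormedSpace.exp (t • Q) *ᵥ f ∈ C := by
  -- Shifting by `c` only multiplies the semigroup by the positive scalar `e^{-tc}`, and every term
  -- of the power series of `e^{t(Q + c)}` preserves the cone.
  have hdecomp : t • Q = t • (Q + c • 1) + (-(t * c)) • (1 : Matrix S S ℝ) := by
    rw [smul_add, smul_smul, add_assoc, ← add_smul]; simp
  rw [hdecomp, Matrix.exp_add_of_commute _ _ ((Commute.one_right _).smul_right _), exp_smul_one,
    mul_smul_comm, mul_one, Matrix.smul_mulVec]
  refine C.smul_mem (Real.exp_pos _).le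
    (exp_mulVec_mem_of_mapsTo hC (fun g hg => ?_) hf)
  rw [Matrix.smul_mulVec, Matrix.add_mulVec, Matrix.smul_mulVec, Matrix.one_mulVec]
  exact C.smul_mem ht (hQ g hg)

/-- If `f` is at least `a` on the neighbours of `x`, then `Q f (x)` is at least
`Q(x, x) (f(x) - a)`. -/
theorem IsGenerator.le_mulVec {Q : Matrix S S ℝ} (hQ : IsGenerator Q) {f : S → ℝ} {x : S} {a : ℝ}
    (h : ∀ y, y ≠ x → Q x y ≠ 0 → a ≤ f y) : Q x x * (f x - a) ≤ (Q *ᵥ f) x := by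
  rw [hQ.mulVec_apply f x a, ← Finset.add_sum_erase _ _ (Finset.mem_univ x)]
  refine le_add_of_nonneg_right (Finset.sum_nonneg fun y hy => ?_)
  have hyx := Finset.ne_of_mem_erase hy
  by_cases h0 : Q x y = 0
  · simp [h0]
  · exact mul_nonneg (hQ.nonneg _ _ hyx.symm) (sub_nonneg.2 (h y hyx h0))

theorem IsGenerator.mulVec_le {Q : Matrix S S ℝ} (hQ : IsGenerator Q) {f : S → ℝ} {x : S} {a : ℝ}
    (h : ∀ y, y ≠ x → Q x y ≠ 0 → f y ≤ a) : (Q *ᵥ f) x ≤ Q x x * (f x - a) := by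
  have := hQ.le_mulVec (f := -f) (x := x) (a := -a) fun y h1 h2 => neg_le_neg (h y h1 h2)
  simp only [Matrix.mulVec_neg, Pi.neg_apply] at this
  linarith

theorem IsGenerator.diag_nonpos {Q : Matrix S S ℝ} (hQ : IsGenerator Q) (x : S) : Q x x ≤ 0 := by
  have := hQ.row_sum x
  rw [← Finset.add_sum_erase _ _ (Finset.mem_univ x)] at this
  have h2 : 0 ≤ ∑ y ∈ Finset.univ.erase x, Q x y :=
    Finset.sum_nonneg fun y hy => hQ.nonneg _ _ (Finset.ne_of_mem_erase hy).symm
  linarith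

/-- Makes `-∑ z, Q z z` a single bound for all exit rates, from which the shifts `c` of the cone
arguments are built. -/
theorem IsGenerator.sum_diag_le {Q : Matrix S S ℝ} (hQ : IsGenerator Q) (x : S) :
    ∑ z, Q z z ≤ Q x x := by
  rw [← Finset.add_sum_erase _ _ (Finset.mem_univ x)]
  have := Finset.sum_nonpos fun y (_ : y ∈ Finset.univ.erase x) => hQ.diag_nonpos y
  linarith

theorem IsGenerator.exp_nonneg {Q : Matrix S S ℝ} (hQ : IsGenerator Q) {t : ℝ} (ht : 0 ≤ t)
    (x y : S) : 0 ≤ NormedSpace.exp (t • Q) x y := by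
  let C : PointedCone ℝ (S → ℝ) :=
    { carrier := {f | ∀ x, 0 ≤ f x}
      add_mem' := fun hf hg x => add_nonneg (hf x) (hg x)
      zero_mem' := fun x => le_rfl
      smul_mem' := fun c f hf x => mul_nonneg c.2 (hf x) }
  have hC : IsClosed (C : Set (S → ℝ)) := by
    have : (C : Set (S → ℝ)) = ⋂ x, {f : S → ℝ | 0 ≤ f x} := by
      ext f; simp [C]
    rw [this]
    exact isClosed_iInter fun x => isClosed_le continuous_const (continuous_apply x)
  have := exp_mulVec_mem hC (Q := Q) (-∑ z, Q z z) (fun f hf x => ?_) ht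
    (f := Pi.single y 1) (fun z => (Pi.single_nonneg.2 zero_le_one : (0 : S → ℝ) ≤ Pi.single y 1) z)
  · simpa using this x
  · have h1 := hQ.le_mulVec (f := f) (x := x) (a := 0) fun z _ _ => hf z
    have h2 := hQ.sum_diag_le x
    have h3 := hf x
    simp only [Pi.add_apply, Pi.smul_apply, smul_eq_mul]
    nlinarith

end Semigroup

/-! ### Symmetric birth-and-death chains: the bound at the middle state -/

section BirthDeath

variable {N : ℕ}

theorem IsBirthDeath.val_le_add_one {Q : Matrix (Fin (N + 1)) (Fin (N + 1)) ℝ} (hbd : IsBirthDeath Q)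
    {x y : Fin (N + 1)} (h : Q x y ≠ 0) : (y : ℕ) ≤ x + 1 ∧ (x : ℕ) ≤ y + 1 := by
  by_contra h'
  exact h (hbd x y (by omega))

theorem IsSymmetric.mulVec_rev {Q : Matrix (Fin (N + 1)) (Fin (N + 1)) ℝ} (hsym : IsSymmetric Q)
    (f : Fin (N + 1) → ℝ) (x : Fin (N + 1)) :
    (Q *ᵥ f) x.rev = (Q *ᵥ fun y => f y.rev) x := by
  simp only [Matrix.mulVec, dotProduct]
  rw [← Equiv.sum_comp Fin.revPerm]
  exact Finset.sum_congr rfl fun y _ => by rw [Fin.revPerm_apply, hsym]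

/-- Functions on `{0, …, N}` that are symmetric and nondecreasing on the left half. -/
def symmUnimodal (N : ℕ) : PointedCone ℝ (Fin (N + 1) → ℝ) where
  carrier := {f | (∀ x : Fin (N + 1), f x.rev = f x) ∧
    ∀ a b : Fin (N + 1), (a : ℕ) + 1 = b → 2 * (b : ℕ) ≤ N → f a ≤ f b}
  add_mem' := fun hf hg =>
    ⟨fun x => congrArg₂ (· + ·) (hf.1 x) (hg.1 x),
      fun a b h h' => add_le_add (hf.2 a b h h') (hg.2 a b h h')⟩
  zero_mem' := ⟨fun _ => rfl, fun _ _ _ _ => le_rfl⟩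
  smul_mem' := fun c _ hf =>
    ⟨fun x => congrArg (c.1 * ·) (hf.1 x),
      fun a b h h' => mul_le_mul_of_nonneg_left (hf.2 a b h h') c.2⟩

theorem mem_symmUnimodal {f : Fin (N + 1) → ℝ} : f ∈ symmUnimodal N ↔
    (∀ x : Fin (N + 1), f x.rev = f x) ∧
      ∀ a b : Fin (N + 1), (a : ℕ) + 1 = b → 2 * (b : ℕ) ≤ N → f a ≤ f b :=
  Iff.rfl

theorem isClosed_symmUnimodal : IsClosed (symmUnimodal N : Set (Fin (N + 1) → ℝ)) := by
  have : (symmUnimodal N : Set (Fin (N + 1) → ℝ)) =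
      {f | (∀ x : Fin (N + 1), f x.rev = f x) ∧
        ∀ a b : Fin (N + 1), (a : ℕ) + 1 = b → 2 * (b : ℕ) ≤ N → f a ≤ f b} := rfl
  rw [this]
  simp only [Set.ofPred_and, Set.ofPred_forall]
  exact (isClosed_iInter fun x => isClosed_eq (continuous_apply x.rev) (continuous_apply x)).inter
    (isClosed_iInter fun a => isClosed_iInter fun b => isClosed_iInter fun _ =>
      isClosed_iInter fun _ => isClosed_le (f := fun f : Fin (N + 1) → ℝ => f a) (g := fun f => f b)
        (continuous_apply a) (continuous_apply b))

theorem apply_zero_le_of_mem_symmUnimodal {f : Fin (N + 1) → ℝ} (hf : f ∈ symmUnimodal N)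
    (x : Fin (N + 1)) : f 0 ≤ f x := by
  have left : ∀ n (hn : n < N + 1), 2 * n ≤ N → f 0 ≤ f ⟨n, hn⟩ := by
    intro n
    induction n with
    | zero => intro _ _; exact le_rfl
    | succ n ih =>
      intro hn h
      exact (ih (by omega) (by omega)).trans (hf.2 _ _ rfl h)
  by_cases hx : 2 * (x : ℕ) ≤ N
  · exact left x x.2 hx
  · rw [← hf.1 x]
    exact left x.rev x.rev.2 (by rw [Fin.val_rev]; omega)

variable {Q : Matrix (Fin (N + 1)) (Fin (N + 1)) ℝ}

/-- On an edge `a, b = a + 1` of the left half, neighbours of `b` have values at least `f a` and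
neighbours of `a` at most `f b`. So `Q f` loses at most `(|Q a a| + |Q b b|) (f b - f a)` of the
increment, which the shift by twice the total exit rate restores. -/
theorem exp_mulVec_mem_symmUnimodal (hQ : IsGenerator Q) (hbd : IsBirthDeath Q)
    (hsym : IsSymmetric Q) {t : ℝ} (ht : 0 ≤ t) {f : Fin (N + 1) → ℝ}
    (hf : f ∈ symmUnimodal N) : NormedSpace.exp (t • Q) *ᵥ f ∈ symmUnimodal N := by
  refine exp_mulVec_mem isClosed_symmUnimodal (-(2 * ∑ z, Q z z))
    (fun f hf => ⟨fun x => ?_, fun a b hab hb => ?_⟩) ht hf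
  · simp only [Pi.add_apply, Pi.smul_apply, smul_eq_mul, hsym.mulVec_rev, hf.1]
  · have hfab := hf.2 a b hab hb
    have h1 : Q b b * (f b - f a) ≤ (Q *ᵥ f) b := by
      refine hQ.le_mulVec fun y hy h => ?_
      have hy' : (y : ℕ) ≠ b := fun h => hy (Fin.ext h)
      have := hbd.val_le_add_one h
      by_cases hya : y = a
      · rw [hya]
      have hya' : (y : ℕ) ≠ a := fun h => hya (Fin.ext h)
      by_cases hyN : 2 * (y : ℕ) ≤ N
      · exact hfab.trans (hf.2 b y (by omega) hyN)
      -- Here `y = b + 1` has crossed the middle, and its mirror image is `a` or `b` according to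
      -- the parity of `N`.
      · rw [← hf.1 y]
        have hr : (y.rev : ℕ) = N - y := by rw [Fin.val_rev]; omega
        by_cases hN : N = 2 * (b : ℕ)
        · rw [show y.rev = a from Fin.ext (by omega)]
        · rw [show y.rev = b from Fin.ext (by omega)]
          exact hfab
    have h2 : (Q *ᵥ f) a ≤ Q a a * (f a - f b) := by
      refine hQ.mulVec_le fun y hy h => ?_
      have hy' : (y : ℕ) ≠ a := fun h => hy (Fin.ext h)
      have := hbd.val_le_add_one h
      by_cases hyb : y = b
      · rw [hyb]
      have hyb' : (y : ℕ) ≠ b := fun h => hyb (Fin.ext h)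
      exact (hf.2 y a (by omega) (by omega)).trans hfab
    have h3 := hQ.sum_diag_le a
    have h4 := hQ.sum_diag_le b
    simp only [Pi.add_apply, Pi.smul_apply, smul_eq_mul]
    nlinarith

/-- Functions on `{0, …, N}` that are antisymmetric and nonnegative on the left half. -/
def antisymmNonneg (N : ℕ) : PointedCone ℝ (Fin (N + 1) → ℝ) where
  carrier := {f | (∀ x : Fin (N + 1), f x.rev = -f x) ∧
    ∀ x : Fin (N + 1), 2 * (x : ℕ) ≤ N → 0 ≤ f x}
  add_mem' := fun {f g} hf hg =>
    ⟨fun x => by simp only [Pi.add_apply, hf.1, hg.1]; ring,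
      fun x h => add_nonneg (hf.2 x h) (hg.2 x h)⟩
  zero_mem' := ⟨fun _ => neg_zero.symm, fun _ _ => le_rfl⟩
  smul_mem' := fun c f hf =>
    ⟨fun x => (congrArg (c.1 * ·) (hf.1 x)).trans (mul_neg _ _),
      fun x h => mul_nonneg c.2 (hf.2 x h)⟩

theorem isClosed_antisymmNonneg : IsClosed (antisymmNonneg N : Set (Fin (N + 1) → ℝ)) := by
  have : (antisymmNonneg N : Set (Fin (N + 1) → ℝ)) =
      {f | (∀ x : Fin (N + 1), f x.rev = -f x) ∧
        ∀ x : Fin (N + 1), 2 * (x : ℕ) ≤ N → 0 ≤ f x} := rfl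
  rw [this]
  simp only [Set.ofPred_and, Set.ofPred_forall]
  exact (isClosed_iInter fun x => isClosed_eq (continuous_apply x.rev) (continuous_apply x).neg).inter
    (isClosed_iInter fun a => isClosed_iInter fun _ =>
      isClosed_le continuous_const (continuous_apply a))

/-- A neighbour of a left state `x` either lies in the left half, with a nonnegative value, or is
the mirror image of `x`, with value `-f x`. The lower bound `-f x` costs `2 |Q x x| f x`, whence the
factor 2 in the shift. -/
theorem exp_mulVec_mem_antisymmNonneg (hQ : IsGenerator Q) (hbd : IsBirthDeath Q)
    (hsym : IsSymmetric Q) {t : ℝ} (ht : 0 ≤ t) {f : Fin (N + 1) → ℝ}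
    (hf : f ∈ antisymmNonneg N) : NormedSpace.exp (t • Q) *ᵥ f ∈ antisymmNonneg N := by
  have hrev : ∀ f ∈ antisymmNonneg N, ∀ x,
      (Q *ᵥ f + (-(2 * ∑ z, Q z z)) • f) x.rev = -(Q *ᵥ f + (-(2 * ∑ z, Q z z)) • f) x := by
    intro f hf x
    have h1 : (fun y : Fin (N + 1) => f y.rev) = -f := funext hf.1
    have h2 := hsym.mulVec_rev f x
    rw [h1, Matrix.mulVec_neg, Pi.neg_apply] at h2
    simp only [Pi.add_apply, Pi.smul_apply, smul_eq_mul, h2, hf.1]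
    ring
  refine exp_mulVec_mem isClosed_antisymmNonneg (-(2 * ∑ z, Q z z))
    (fun f hf => ⟨hrev f hf, fun x hx => ?_⟩) ht hf
  by_cases hxN : 2 * (x : ℕ) = N
  · have := hrev f hf x
    rw [show x.rev = x from Fin.ext (by rw [Fin.val_rev]; omega)] at this
    linarith
  have hfx := hf.2 x hx
  have h1 : Q x x * (f x - -f x) ≤ (Q *ᵥ f) x := by
    refine hQ.le_mulVec fun y hy h => ?_
    have hy' : (y : ℕ) ≠ x := fun h => hy (Fin.ext h)
    have := hbd.val_le_add_one h
    by_cases hyN : 2 * (y : ℕ) ≤ N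
    · have := hf.2 y hyN
      linarith
    · have := hf.1 y
      rw [show y.rev = x from Fin.ext (by rw [Fin.val_rev]; omega)] at this
      linarith
  have h2 := hQ.sum_diag_le x
  simp only [Pi.add_apply, Pi.smul_apply, smul_eq_mul]
  nlinarith

/-- Irreducibility forces a positive rate through each cut of a birth-and-death chain. -/
theorem IsIrreducible.pos_of_add_one (hirr : IsIrreducible Q) (hbd : IsBirthDeath Q)
    {a b : Fin (N + 1)} (hab : (a : ℕ) + 1 = b) : 0 < Q a b := by
  by_contra h0
  have key : ∀ y, Relation.ReflTransGen (fun a b => a ≠ b ∧ 0 < Q a b) a y → y ≤ a := by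
    intro y hy
    induction hy with
    | refl => exact le_rfl
    | @tail u v _ huv ih =>
      by_contra hv
      have h1 := hbd.val_le_add_one huv.2.ne'
      have h2 : (u : ℕ) ≤ a := ih
      have h3 : (a : ℕ) < v := not_le.1 hv
      rw [show u = a from Fin.ext (by omega), show v = b from Fin.ext (by omega)] at huv
      exact h0 huv.2
  have : (b : ℕ) ≤ a := key b (hirr a b)
  omega

/-- A stationary distribution of a birth-and-death chain satisfies detailed balance. -/
theorem IsStationary.detailed_balance (hQ : IsGenerator Q) (hbd : IsBirthDeath Q)
    {p : Fin (N + 1) → ℝ} (hp : p ᵥ* Q = 0) {a b : Fin (N + 1)} (hab : (a : ℕ) + 1 = b) :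
    p a * Q a b = p b * Q b a := by
  -- With the indicator of `{x ≤ a}` as test function, `Q f` vanishes off the cut, and `p · Q f = 0`
  -- says that the net flux through it is zero.
  set f : Fin (N + 1) → ℝ := fun x => if x ≤ a then 1 else 0 with hf
  have hfa : f a = 1 := if_pos le_rfl
  have hfb : f b = 0 := if_neg fun h => by
    have : (b : ℕ) ≤ a := h
    omega
  have hfe : ∀ x y, Q x y ≠ 0 → ¬(x = a ∧ y = b) → ¬(x = b ∧ y = a) → f y = f x := by
    intro x y h h1 h2
    have := hbd.val_le_add_one h
    simp only [Fin.ext_iff] at h1 h2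
    simp only [hf, Fin.le_iff_val_le_val]
    congr 1
    exact propext ⟨fun _ => by omega, fun _ => by omega⟩
  have hba : b ≠ a := fun h => by rw [h] at hab; omega
  have hQfa : (Q *ᵥ f) a = -Q a b := by
    rw [hQ.mulVec_apply f a (f a), Finset.sum_eq_single b]
    · rw [hfa, hfb]; ring
    · intro y _ hy
      by_cases h : Q a y = 0
      · rw [h, zero_mul]
      · rw [hfe a y h (fun h => hy h.2) (fun h => hba h.1.symm), sub_self, mul_zero]
    · exact fun h => absurd (Finset.mem_univ _) h
  have hQfb : (Q *ᵥ f) b = Q b a := by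
    rw [hQ.mulVec_apply f b (f b), Finset.sum_eq_single a]
    · rw [hfa, hfb]; ring
    · intro y _ hy
      by_cases h : Q b y = 0
      · rw [h, zero_mul]
      · rw [hfe b y h (fun h => hba h.1) (fun h => hy h.2), sub_self, mul_zero]
    · exact fun h => absurd (Finset.mem_univ _) h
  have hQfx : ∀ x, x ≠ a → x ≠ b → (Q *ᵥ f) x = 0 := by
    intro x hxa hxb
    rw [hQ.mulVec_apply f x (f x)]
    refine Finset.sum_eq_zero fun y _ => ?_
    by_cases h : Q x y = 0
    · rw [h, zero_mul]
    · rw [hfe x y h (fun h => hxa h.1) (fun h => hxb h.1), sub_self, mul_zero]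
  have h0 : p ⬝ᵥ (Q *ᵥ f) = 0 := by rw [Matrix.dotProduct_mulVec, hp, zero_dotProduct]
  rw [dotProduct, Finset.sum_eq_add (b) (a) hba] at h0
  · rw [hQfa, hQfb] at h0
    linarith
  · intro x _ hx
    rw [hQfx x hx.2 hx.1, mul_zero]
  · exact fun h => absurd (Finset.mem_univ _) h
  · exact fun h => absurd (Finset.mem_univ _) h

/-- For odd `N` the two states are joined by the middle edge, whose two rates agree by symmetry, so
detailed balance there equates their masses. For even `N` they coincide. -/
theorem IsStationary.rev_half_eq {p : Fin (N + 1) → ℝ} (hQ : IsGenerator Q)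
    (hirr : IsIrreducible Q) (hbd : IsBirthDeath Q) (hsym : IsSymmetric Q) (hp : p ᵥ* Q = 0)
    {a : Fin (N + 1)} (ha : (a : ℕ) = (N + 1) / 2) : p a.rev = p a := by
  have hr : (a.rev : ℕ) = N - (N + 1) / 2 := by rw [Fin.val_rev]; omega
  rcases Nat.even_or_odd' N with ⟨m, hm | hm⟩
  · rw [show a.rev = a from Fin.ext (by omega)]
  · have hra : (a.rev : ℕ) + 1 = a := by omega
    have h1 := IsStationary.detailed_balance hQ hbd hp hra
    have h2 := hsym a.rev a
    rw [Fin.rev_rev] at h2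
    rw [h2] at h1
    exact mul_right_cancel₀ (hirr.pos_of_add_one hbd hra).ne' h1

/-- The middle state of a symmetric birth-and-death chain started at `0` is never more likely
than it is at equilibrium. -/
theorem exp_zero_half_le {p : Fin (N + 1) → ℝ} (hQ : IsGenerator Q)
    (hirr : IsIrreducible Q) (hbd : IsBirthDeath Q) (hsym : IsSymmetric Q)
    (hp : IsStationary Q p) {a : Fin (N + 1)} (ha : (a : ℕ) = (N + 1) / 2) {t : ℝ} (ht : 0 ≤ t) :
    NormedSpace.exp (t • Q) 0 a ≤ p a := by
  have hr : (a.rev : ℕ) = N - (N + 1) / 2 := by rw [Fin.val_rev]; omega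
  have hsingle : ∀ x y : Fin (N + 1),
      (Pi.single x 1 : Fin (N + 1) → ℝ) y.rev = (Pi.single x.rev 1 : Fin (N + 1) → ℝ) y := by
    intro x y
    simp only [Pi.single_apply, Fin.rev_eq_iff]
  have hnonneg : ∀ x y : Fin (N + 1), (0 : ℝ) ≤ (Pi.single x 1 : Fin (N + 1) → ℝ) y := by
    intro x y
    rw [Pi.single_apply]
    split_ifs <;> norm_num
  have hg : (Pi.single a 1 + Pi.single a.rev 1 : Fin (N + 1) → ℝ) ∈ symmUnimodal N := by
    refine ⟨fun x => ?_, fun x y hxy hy => ?_⟩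
    · simp only [Pi.add_apply, hsingle, Fin.rev_rev]
      ring
    · have h1 : x ≠ a := fun h => by subst h; omega
      have h2 : x ≠ a.rev := fun h => by rw [h] at hxy; omega
      simp only [Pi.add_apply, Pi.single_eq_of_ne h1, Pi.single_eq_of_ne h2]
      exact le_trans (by norm_num) (add_nonneg (hnonneg a y) (hnonneg a.rev y))
  have hd : (Pi.single a.rev 1 - Pi.single a 1 : Fin (N + 1) → ℝ) ∈ antisymmNonneg N := by
    refine ⟨fun x => ?_, fun x hx => ?_⟩
    · simp only [Pi.sub_apply, hsingle, Fin.rev_rev]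
      ring
    · simp only [Pi.sub_apply]
      -- The negative term is met in the left half only if `N` is even, and then the two indicators
      -- cancel.
      by_cases hxa : x = a
      · rw [show a.rev = a from Fin.ext (by subst hxa; omega), sub_self]
      · rw [Pi.single_eq_of_ne hxa, sub_zero]
        exact hnonneg _ _
  have hg' := apply_zero_le_of_mem_symmUnimodal (exp_mulVec_mem_symmUnimodal hQ hbd hsym ht hg)
  have hd' := (exp_mulVec_mem_antisymmNonneg hQ hbd hsym ht hd).2 0 (by simp)
  -- The minimum, attained at `0`, is at most the mean under `p`, which the semigroup leaves
  -- unchanged.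
  have hmean : (NormedSpace.exp (t • Q) *ᵥ (Pi.single a 1 + Pi.single a.rev 1)) 0 ≤
      p a + p a.rev := by
    have hstat : p ᵥ* NormedSpace.exp (t • Q) = p :=
      vecMul_exp_of_vecMul_eq_zero (by rw [Matrix.vecMul_smul, hp.vecMul_eq_zero, smul_zero])
    have h1 : p a + p a.rev =
        p ⬝ᵥ (NormedSpace.exp (t • Q) *ᵥ (Pi.single a 1 + Pi.single a.rev 1)) := by
      rw [Matrix.dotProduct_mulVec, hstat, dotProduct_add]
      simp
    rw [h1, dotProduct]
    refine le_of_eq_of_le ?_ (?_ : ∑ x, p x * (NormedSpace.exp (t • Q) *ᵥ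
      (Pi.single a 1 + Pi.single a.rev 1)) 0 ≤ _)
    · rw [← Finset.sum_mul, hp.sum_eq_one, one_mul]
    exact Finset.sum_le_sum fun x _ => mul_le_mul_of_nonneg_left (hg' x) (hp.nonneg x)
  simp only [Matrix.mulVec_add, Matrix.mulVec_sub, Pi.add_apply, Pi.sub_apply,
    Matrix.mulVec_single_one, Matrix.col_apply] at hmean hd'
  have := IsStationary.rev_half_eq hQ hirr hbd hsym hp.vecMul_eq_zero ha
  linarith

end BirthDeath

/-! ### Total variation and hitting times of right-continuous paths -/

theorem tvDist_le_sum {S : Type*} [Fintype S] {p q w : S → ℝ} (hpq : ∑ x, p x = ∑ x, q x)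
    (hw : ∀ x, 0 ≤ w x)
    (h : ∀ x, p x - q x ≤ w x) : tvDist p q ≤ ∑ x, w x := by
  -- The added differences have total zero and replace `|d|` by twice the positive part of `d`.
  have h1 : ∑ x, |p x - q x| = ∑ x, (|p x - q x| + (p x - q x)) := by
    rw [Finset.sum_add_distrib, Finset.sum_sub_distrib, hpq, sub_self, add_zero]
  rw [tvDist, h1, Finset.mul_sum]
  refine Finset.sum_le_sum fun x _ => ?_
  rcases abs_cases (p x - q x) with ⟨h2, _⟩ | ⟨h2, _⟩ <;> linarith [h x, hw x]

/-- A right-continuous path that avoids `a` on the dyadic subdivisions of `[0, t]` avoids it on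
`[0, t]`. -/
theorem ne_of_forall_dyadic_ne {S : Type*} {f : ℝ≥0 → S} {a : S} {t : ℝ≥0}
    (hf : ∀ t : ℝ≥0, ∃ ε > 0, ∀ s, t ≤ s → s < t + ε → f s = f t)
    (hgrid : ∀ k i : ℕ, i ≤ 2 ^ k → f (i * (t / 2 ^ k)) ≠ a) : ∀ s ≤ t, f s ≠ a := by
  intro s hs hsa
  rcases hs.eq_or_lt with rfl | hst
  · refine hgrid 0 1 le_rfl ?_
    simpa using hsa
  obtain ⟨ε, hε, h⟩ := hf s
  have ht : 0 < t := zero_le.trans_lt hst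
  obtain ⟨k, hk⟩ := exists_nat_gt (t / ε)
  have hpow : (0 : ℝ≥0) < 2 ^ k := by positivity
  have hmesh : 0 < t / 2 ^ k := div_pos ht hpow
  have hk' : t / 2 ^ k < ε := by
    rw [div_lt_iff₀ hpow, mul_comm, ← div_lt_iff₀ hε]
    exact hk.trans (by exact_mod_cast Nat.lt_two_pow_self)
  -- The first grid point at or after `s` is within one mesh, hence within `ε`, where the path still
  -- equals `a`.
  set i := ⌈s / (t / 2 ^ k)⌉₊ with hi
  refine hgrid k i ?_ (hsa ▸ h _ ?_ ?_)
  · rw [hi, Nat.ceil_le, div_le_iff₀ hmesh]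
    push_cast
    rw [mul_div_cancel₀ _ hpow.ne']
    exact hst.le
  · rw [← div_le_iff₀ hmesh]
    exact Nat.le_ceil _
  · calc (i : ℝ≥0) * (t / 2 ^ k) < (s / (t / 2 ^ k) + 1) * (t / 2 ^ k) :=
          mul_lt_mul_of_pos_right (Nat.ceil_lt_add_one zero_le) hmesh
      _ = s + t / 2 ^ k := by rw [add_mul, div_mul_cancel₀ _ hmesh.ne', one_mul]
      _ < s + ε := by gcongr

/-- Right-continuity at `t` extends the avoidance to `[t, t + ε)`, which makes the inequality
strict. -/
theorem lt_hittingAfter {S Ω : Type*} {f : ℝ≥0 → Ω → S} {a : S} {t : ℝ≥0} {ω : Ω}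
    (hf : ∀ t : ℝ≥0, ∃ ε > 0, ∀ s, t ≤ s → s < t + ε → f s ω = f t ω)
    (h : ∀ s ≤ t, f s ω ≠ a) : (t : WithTop ℝ≥0) < hittingAfter f {a} 0 ω := by
  rw [hittingAfter_def]
  dsimp only
  split_ifs with hex
  · rw [WithTop.coe_lt_coe]
    obtain ⟨ε, hε, hc⟩ := hf t
    refine (lt_add_of_pos_right t hε).trans_le (le_csInf hex ?_)
    rintro s ⟨_, hs⟩
    by_contra! hlt
    rcases le_total s t with hst | hst
    · exact h s hst hs
    · exact h t le_rfl ((hc s hst hlt).symm.trans hs)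
  · exact WithTop.coe_lt_top t

/-! ### From the pointwise bound to the halting set -/

section Markov

variable {S Ω : Type*} [Fintype S] [DecidableEq S] [MeasurableSpace Ω]
  {Q : Matrix S S ℝ} {p₀ : S → ℝ} {P : Measure Ω} [IsProbabilityMeasure P] {X : ℝ≥0 → Ω → S}

/-- A finite-valued map with measurable fibres: probabilities of preimages are finite sums. -/
theorem real_inter_eq_sum {T : Type*} [Finite T] {Z : Ω → T}
    (hZ : ∀ z, MeasurableSet {ω | Z ω = z}) (B : Finset T) {F : Set Ω} (hF : MeasurableSet F) :
    P.real ({ω | Z ω ∈ B} ∩ F) = ∑ z ∈ B, P.real ({ω | Z ω = z} ∩ F) := by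
  rw [← measureReal_biUnion_finset]
  · congr 1
    ext ω
    simp
  · intro z _ z' _ hzz'
    rw [Function.onFun, Set.disjoint_left]
    rintro ω ⟨h1, _⟩ ⟨h2, _⟩
    exact hzz' (h1.symm.trans h2)
  · exact fun z _ => (hZ z).inter hF

theorem IsMarkovChain.law_eq (hX : IsMarkovChain Q p₀ P X) (t : ℝ≥0) :
    law P X t = p₀ ᵥ* NormedSpace.exp ((t : ℝ) • Q) := by
  ext x
  have h1 := real_inter_eq_sum (P := P) (hX.measurableSet_eq 0) Finset.univ
    (hX.measurableSet_eq t x)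
  simp only [Finset.mem_univ, Set.ofPred_true, Set.univ_inter] at h1
  rw [law, h1, Matrix.vecMul, dotProduct]
  refine Finset.sum_congr rfl fun y _ => ?_
  have h2 := hX.finite_dim 1 ![0, t] (by
    rw [Fin.monotone_iff_le_succ]; intro i; fin_cases i; simp) rfl ![y, x]
  rw [← Set.ofPred_and]
  simpa [Fin.forall_fin_two] using h2

/-- The probability of avoiding `a` at the times `0, h, …, n h` and being at `x` at time `n h`. -/
noncomputable def avoidLaw (P : Measure Ω) (X : ℝ≥0 → Ω → S) (h : ℝ≥0) (a : S)
    (n : ℕ) (x : S) : ℝ :=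
  P.real {ω | (∀ i ≤ n, X (i * h) ω ≠ a) ∧ X (n * h) ω = x}

/-- The Markov property applied to each grid path avoiding `a`, the paths being then grouped by last
state. Since `x ≠ a`, avoidance at the new time is automatic. -/
theorem IsMarkovChain.avoidLaw_succ (hX : IsMarkovChain Q p₀ P X) (h : ℝ≥0) {a x : S}
    (hx : x ≠ a) (n : ℕ) :
    avoidLaw P X h a (n + 1) x =
      (avoidLaw P X h a n ᵥ* NormedSpace.exp ((h : ℝ) • Q)) x := by
  set Z : Ω → Fin (n + 1) → S := fun ω i => X (i * h) ω with hZdef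
  have hpath : ∀ (m : ℕ) (z : Fin (m + 1) → S),
      P.real {ω | ∀ i : Fin (m + 1), X (i * h) ω = z i} =
      p₀ (z 0) * ∏ i : Fin m, NormedSpace.exp ((h : ℝ) • Q) (z i.castSucc) (z i.succ) := by
    intro m z
    rw [hX.finite_dim m (fun i => i * h) ?_ (by simp) z]
    · congr 1
      refine Finset.prod_congr rfl fun i _ => ?_
      push_cast [Fin.val_succ, Fin.val_castSucc]
      ring_nf
    · intro i j hij
      exact mul_le_mul_left (Nat.cast_le.2 hij) h
  have hstep : ∀ (z : Fin (n + 1) → S) (x : S),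
      P.real ({ω | Z ω = z} ∩ {ω | X ((n + 1 : ℕ) * h) ω = x}) =
        P.real {ω | Z ω = z} * NormedSpace.exp ((h : ℝ) • Q) (z (Fin.last n)) x := by
    intro z x
    have h1 := hpath (n + 1) (Fin.snoc z x)
    rw [Fin.prod_univ_castSucc, ← mul_assoc] at h1
    simp only [Fin.snoc_castSucc, Fin.succ_last, Fin.snoc_last, Fin.succ_castSucc] at h1
    have h0 : (Fin.snoc z x : Fin (n + 1 + 1) → S) 0 = z 0 := by
      rw [← Fin.castSucc_zero, Fin.snoc_castSucc]
    rw [h0, ← hpath n z] at h1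
    convert h1 using 2
    · ext ω
      simp only [Set.mem_inter_iff, Set.mem_ofPred_eq, hZdef, funext_iff,
        Fin.forall_fin_succ' (n := n + 1)]
      simp
    · simp [hZdef, funext_iff]
  have hZmeas : ∀ z, MeasurableSet {ω | Z ω = z} := by
    intro z
    have : {ω | Z ω = z} = ⋂ i : Fin (n + 1), {ω | X (i * h) ω = z i} := by
      ext ω; simp [hZdef, funext_iff]
    rw [this]
    exact MeasurableSet.iInter fun i => hX.measurableSet_eq _ _
  have hsum : ∀ y : S, avoidLaw P X h a n y = ∑ z : Fin (n + 1) → S with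
      (∀ i, z i ≠ a) ∧ z (Fin.last n) = y, P.real {ω | Z ω = z} := by
    intro y
    have := real_inter_eq_sum (P := P) hZmeas
      (Finset.univ.filter fun z => (∀ i, z i ≠ a) ∧ z (Fin.last n) = y) MeasurableSet.univ
    simp only [Set.inter_univ] at this
    rw [← this, avoidLaw]
    congr 1
    ext ω
    simp [hZdef, Fin.forall_iff]
  have hsum' : avoidLaw P X h a (n + 1) x = ∑ z : Fin (n + 1) → S with
      (∀ i, z i ≠ a), P.real {ω | Z ω = z} * NormedSpace.exp ((h : ℝ) • Q) (z (Fin.last n)) x := by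
    have := real_inter_eq_sum (P := P) hZmeas
      (Finset.univ.filter fun z => (∀ i, z i ≠ a)) (hX.measurableSet_eq ((n + 1 : ℕ) * h) x)
    simp only [hstep] at this
    rw [← this, avoidLaw]
    congr 1
    ext ω
    simp only [Set.mem_inter_iff, Set.mem_ofPred_eq, Finset.mem_filter, Finset.mem_univ, true_and,
      hZdef, Fin.forall_iff, Nat.lt_succ_iff]
    constructor
    · rintro ⟨h1, h2⟩
      exact ⟨fun i hi => h1 i (hi.trans n.le_succ), h2⟩
    · rintro ⟨h1, h2⟩
      refine ⟨fun i hi => ?_, h2⟩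
      rcases Nat.le_succ_iff.1 hi with hi | rfl
      · exact h1 i hi
      · exact h2 ▸ hx
  rw [hsum', Matrix.vecMul, dotProduct, ← Finset.sum_fiberwise _ (fun z => z (Fin.last n))]
  refine Finset.sum_congr rfl fun y _ => ?_
  rw [hsum, Finset.sum_mul, Finset.filter_filter]
  refine Finset.sum_congr rfl fun z hz => ?_
  rw [(Finset.mem_filter.1 hz).2.2]

/-- As long as `a` is never more likely than at equilibrium, the excess of the law of the chain
over equilibrium is dominated by the law on the event that `a` has been avoided. -/
theorem IsMarkovChain.law_sub_le_avoidLaw (hX : IsMarkovChain Q p₀ P X) (hQ : IsGenerator Q)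
    {p : S → ℝ} (hp : IsStationary Q p) {a : S} (ha : ∀ t, law P X t a ≤ p a) (h : ℝ≥0) (n : ℕ) :
    ∀ x, law P X (n * h) x - p x ≤ avoidLaw P X h a n x := by
  have hnonneg : ∀ n x, 0 ≤ avoidLaw P X h a n x := fun n x => measureReal_nonneg
  induction n with
  | zero =>
    intro x
    by_cases hx : x = a
    · subst hx
      linarith [ha ((0 : ℕ) * h), hnonneg 0 x]
    · have : avoidLaw P X h a 0 x = law P X ((0 : ℕ) * h) x := by
        unfold avoidLaw law
        congr 1
        ext ω
        simp only [Nat.le_zero, forall_eq, Set.mem_ofPred_eq, and_iff_right_iff_imp]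
        exact fun h => h ▸ hx
      rw [this]
      linarith [hp.nonneg x]
  | succ n ih =>
    intro x
    by_cases hx : x = a
    · subst hx
      linarith [ha ((n + 1 : ℕ) * h), hnonneg (n + 1) x]
    -- Subtracting the stationary `p` keeps the recursion linear, and nonnegativity of the kernel
    -- transports the induction hypothesis.
    · have hlaw : law P X ((n + 1 : ℕ) * h) - p =
          (law P X (n * h) - p) ᵥ* NormedSpace.exp ((h : ℝ) • Q) := by
        have hstat : p ᵥ* NormedSpace.exp ((h : ℝ) • Q) = p :=
          vecMul_exp_of_vecMul_eq_zero (by rw [Matrix.vecMul_smul, hp.vecMul_eq_zero, smul_zero])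
        rw [Matrix.sub_vecMul, hstat, hX.law_eq, hX.law_eq, Matrix.vecMul_vecMul, ← exp_add_smul]
        congr 4
        push_cast
        ring
      rw [hX.avoidLaw_succ h hx, ← Pi.sub_apply, hlaw]
      exact Finset.sum_le_sum fun y _ =>
        mul_le_mul_of_nonneg_right (ih y) (hQ.exp_nonneg h.2 y x)

theorem IsMarkovChain.sum_law (hX : IsMarkovChain Q p₀ P X) (t : ℝ≥0) :
    ∑ x, law P X t x = 1 := by
  have := real_inter_eq_sum (P := P) (hX.measurableSet_eq t) Finset.univ MeasurableSet.univ
  simpa [law] using this.symm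

theorem IsMarkovChain.tvDist_le_avoid (hX : IsMarkovChain Q p₀ P X) (hQ : IsGenerator Q)
    {p : S → ℝ} (hp : IsStationary Q p) {a : S} (ha : ∀ t, law P X t a ≤ p a) (h : ℝ≥0) (n : ℕ) :
    tvDist (law P X (n * h)) p ≤ P.real {ω | ∀ i ≤ n, X (i * h) ω ≠ a} := by
  have hF : MeasurableSet {ω | ∀ i ≤ n, X (i * h) ω ≠ a} := by
    have : {ω | ∀ i ≤ n, X (i * h) ω ≠ a} = ⋂ i, ⋂ (_ : i ≤ n), {ω | X (i * h) ω = a}ᶜ := by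
      ext ω; simp
    rw [this]
    exact MeasurableSet.iInter fun i => MeasurableSet.iInter fun _ =>
      (hX.measurableSet_eq _ _).compl
  have h1 := real_inter_eq_sum (P := P) (hX.measurableSet_eq (n * h)) Finset.univ hF
  simp only [Finset.mem_univ, Set.ofPred_true, Set.univ_inter] at h1
  rw [h1]
  refine (tvDist_le_sum (w := avoidLaw P X h a n) ?_ (fun _ => measureReal_nonneg)
    (hX.law_sub_le_avoidLaw hQ hp ha h n)).trans_eq (Finset.sum_congr rfl fun x _ => ?_)
  · rw [hX.sum_law, hp.sum_eq_one]
  · rw [avoidLaw, Set.inter_comm]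
    rfl

/-- A state that is never more likely than at equilibrium is a halting set. -/
theorem IsMarkovChain.isHaltingSet_singleton (hX : IsMarkovChain Q p₀ P X) (hQ : IsGenerator Q)
    {p : S → ℝ} (hp : IsStationary Q p) {a : S} (ha : ∀ t, law P X t a ≤ p a) :
    IsHaltingSet P X p {a} := by
  intro t
  set E : ℕ → Set Ω := fun k => {ω | ∀ i : ℕ, i ≤ 2 ^ k → X (i * (t / 2 ^ k)) ω ≠ a} with hE
  have hEmeas : ∀ k, MeasurableSet (E k) := by
    intro k
    have : E k = ⋂ i : ℕ, ⋂ (_ : i ≤ 2 ^ k), {ω | X (i * (t / 2 ^ k)) ω = a}ᶜ := by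
      ext ω; simp [hE]
    rw [this]
    exact MeasurableSet.iInter fun i => MeasurableSet.iInter fun _ =>
      (hX.measurableSet_eq _ _).compl
  have hEanti : Antitone E := by
    refine antitone_nat_of_succ_le fun k ω hω i hi => ?_
    -- Each grid is contained in the next: point `i` becomes point `2 * i`.
    have := hω (2 * i) (by rw [pow_succ]; omega)
    convert this using 2
    push_cast
    rw [pow_succ]
    field_simp
  have hEle : ∀ k, tvDist (law P X t) p ≤ P.real (E k) := by
    intro k
    have := hX.tvDist_le_avoid hQ hp ha (t / 2 ^ k) (2 ^ k)
    rwa [show ((2 ^ k : ℕ) : ℝ≥0) * (t / 2 ^ k) = t by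
      push_cast
      exact mul_div_cancel₀ _ (by positivity)] at this
  have hlim : Filter.Tendsto (fun k => P.real (E k)) Filter.atTop (nhds (P.real (⋂ k, E k))) :=
    (ENNReal.tendsto_toReal (measure_ne_top _ _)).comp
      (tendsto_measure_iInter_atTop (fun k => (hEmeas k).nullMeasurableSet) hEanti
        ⟨0, measure_ne_top _ _⟩)
  refine (ge_of_tendsto' hlim hEle).trans ?_
  -- Only an almost sure inclusion of events is needed, so measurability of the hitting event plays
  -- no role.
  refine ENNReal.toReal_mono (measure_ne_top _ _) (measure_mono_ae ?_)
  filter_upwards [hX.right_continuous] with ω hω hωE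
  exact lt_hittingAfter hω (ne_of_forall_dyadic_ne hω fun k i hi => Set.mem_iInter.1 hωE k i hi)

end Markov

end HaltingState

theorem mainTheorem10 (N : ℕ) (Q : Matrix (Fin (N + 1)) (Fin (N + 1)) ℝ)
    (hQ : HaltingState.IsGenerator Q) (hirr : HaltingState.IsIrreducible Q)
    (hbd : HaltingState.IsBirthDeath Q) (hsym : HaltingState.IsSymmetric Q)
    (π : Fin (N + 1) → ℝ) (hπ : HaltingState.IsStationary Q π)
    {Ω : Type*} [MeasurableSpace Ω] (P : Measure Ω) [IsProbabilityMeasure P]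
    (X : ℝ≥0 → Ω → Fin (N + 1))
    (hX : HaltingState.IsMarkovChain Q (Pi.single 0 1) P X) :
    HaltingState.IsHaltingState P X π
      ⟨(N + 1) / 2, Nat.div_lt_self N.succ_pos Nat.one_lt_two⟩ := by
  set a : Fin (N + 1) := ⟨(N + 1) / 2, Nat.div_lt_self N.succ_pos Nat.one_lt_two⟩
  have hle : ∀ t : ℝ≥0, HaltingState.law P X t a ≤ π a := by
    intro t
    rw [hX.law_eq, Matrix.single_one_vecMul]
    exact HaltingState.exp_zero_half_le hQ hirr hbd hsym hπ rfl t.2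
  exact ⟨hle, hX.isHaltingSet_singleton hQ hπ hle⟩
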